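/- Let $K$ be a division ring with an involutive antiautomorphism $\lambda\mapsto\lambda^*$, let $V$ be a left vector space over $K$ with $\dim V\ge 3$, and let $f:V\times V\to K$ be a Hermitian form: $f(\lambda u+\mu v,w)=\lambda f(u,w)+\mu f(v,w)$, $f(u,v)^*=f(v,u)$, and $f(v,v)=0$ implies $v=0$. For a subspace $M\subseteq V$ put $M^\perp=\{v\in V\mid f(v,x)=0\text{ for all }x\in M\}$, and let $\mathbf L_f(V)$ be the lattice, ordered by inclusion, of all subspaces $M$ with $M=M^{\perp\perp}$. Assume that $(V,K,{}^*,f)$ is orthomodular, that is, $M+M^\perp=V$ for every $M\in\mathbf L_f(V)$. Let $\mathbf P(V)$ be the set of atoms of $\mathbf L_f(V)$; these are the one-dimensional subspaces $[v]=Kv$, $v\neq 0$. Two atoms $p,q$ are orthogonal, $p\perp q$, if $p\subseteq q^\perp$. Let ${\rm Aut}_o(\mathbf P(V))$ be the group of orthosymmetries, that is, of bijections $\ell:\mathbf P(V)\to\mathbf P(V)$ such that $p\perp q\iff\ell(p)\perp\ell(q)$ for all $p,q\in\mathbf P(V)$. Suppose that (A) ${\rm Aut}_o(\mathbf P(V))$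 is abundant: for any two orthogonal atoms $[x],[y]\in\mathbf P(V)$ there is an $\ell\in{\rm Aut}_o(\mathbf P(V))$ with $\ell([x])=[y]$, $\ell([y])=[x]$, and $\ell([v])=[v]$ for some atom $[v]\le[x]\vee[y]$; (R) $f$ is regular: for every $v\in V$, $f(v,v)$ lies in the centre of $K$, and $g(f(v,v))=f(v,v)$ for every ring automorphism $g$ of $K$. Then for any two orthogonal atoms $[x],[y]\in\mathbf P(V)$ there are nonzero vectors $x'\in[x]$ and $y'\in[y]$ such that $f(x',x')=f(y',y')$. -/

import Mathlib

/-- A Hermitian form on a left vector space `V` over a division ring `K` with an involutive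
antiautomorphism `star`: linear in the first argument, Hermitian symmetric, and anisotropic. -/
structure HermitianForm (K V : Type*) [DivisionRing K] [StarRing K] [AddCommGroup V]
    [Module K V] where
  toFun : V → V → K
  linear_left : ∀ (a b : K) (u v w : V),
    toFun (a • u + b • v) w = a * toFun u w + b * toFun v w
  star_symm : ∀ u v : V, star (toFun u v) = toFun v u
  anisotropic : ∀ v : V, toFun v v = 0 → v = 0

namespace HermitianForm

variable {K V : Type*} [DivisionRing K] [StarRing K] [AddCommGroup V] [Module K V]

instance : CoeFun (HermitianForm K V) (fun _ => V → V → K) := ⟨HermitianForm.toFun⟩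

theorem zero_left (f : HermitianForm K V) (w : V) : f 0 w = 0 := by
  simpa using f.linear_left 0 0 0 0 w

theorem add_left (f : HermitianForm K V) (u v w : V) : f (u + v) w = f u w + f v w := by
  simpa using f.linear_left 1 1 u v w

theorem smul_left (f : HermitianForm K V) (a : K) (u w : V) : f (a • u) w = a * f u w := by
  simpa using f.linear_left a 0 u 0 w

theorem eq_zero_symm (f : HermitianForm K V) {u v : V} (h : f u v = 0) : f v u = 0 := by
  rw [← f.star_symm u v, h, star_zero]

/-- The orthogonal complement `M^⊥ = {v | f(v, x) = 0 for all x ∈ M}`. -/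
def perp (f : HermitianForm K V) (M : Submodule K V) : Submodule K V where
  carrier := {v | ∀ x ∈ M, f v x = 0}
  add_mem' := by
    intro a b ha hb x hx
    rw [f.add_left, ha x hx, hb x hx, add_zero]
  zero_mem' := fun x _ => f.zero_left x
  smul_mem' := by
    intro c a ha x hx
    rw [f.smul_left, ha x hx, mul_zero]

theorem perp_anti (f : HermitianForm K V) {M N : Submodule K V} (h : M ≤ N) :
    f.perp N ≤ f.perp M := fun _ hv x hx => hv x (h hx)

theorem le_perp_perp (f : HermitianForm K V) (M : Submodule K V) : M ≤ f.perp (f.perp M) :=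
  fun _ hx _ hy => f.eq_zero_symm (hy _ hx)

theorem perp_perp_perp (f : HermitianForm K V) (M : Submodule K V) :
    f.perp (f.perp (f.perp M)) = f.perp M :=
  le_antisymm (f.perp_anti (f.le_perp_perp M)) (f.le_perp_perp _)

/-- The set `L_f(V)` of `f`-closed subspaces, that is, of the subspaces `M` with `M = M^⊥⊥`,
ordered by inclusion. -/
def ClosedSubspace (f : HermitianForm K V) : Type _ :=
  {M : Submodule K V // f.perp (f.perp M) = M}

instance (f : HermitianForm K V) : PartialOrder f.ClosedSubspace :=
  inferInstanceAs (PartialOrder {M : Submodule K V // f.perp (f.perp M) = M})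

/-- The closure `M ↦ M^⊥⊥` and the inclusion of `L_f(V)` into all subspaces. -/
def closureInsertion (f : HermitianForm K V) :
    GaloisInsertion (fun M : Submodule K V => (⟨f.perp (f.perp M), f.perp_perp_perp _⟩ :
      f.ClosedSubspace)) (fun N : f.ClosedSubspace => N.1) where
  choice M hM := ⟨M, le_antisymm hM (f.le_perp_perp M)⟩
  gc M N := by
    constructor
    · exact fun h => (f.le_perp_perp M).trans h
    · intro h
      have h2 : f.perp (f.perp M) ≤ f.perp (f.perp N.1) := f.perp_anti (f.perp_anti h)
      rw [N.2] at h2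
      exact h2
  le_l_u N := f.le_perp_perp N.1
  choice_eq M hM := Subtype.ext (le_antisymm (f.le_perp_perp M) hM)

/-- `L_f(V)` is a complete lattice under inclusion; the join of `M` and `N` is `(M + N)^⊥⊥`. -/
instance (f : HermitianForm K V) : CompleteLattice f.ClosedSubspace :=
  { f.closureInsertion.liftCompleteLattice with
    toPartialOrder := inferInstance }

/-- The orthocomplementation `M ↦ M^⊥` of `L_f(V)`. -/
def ClosedSubspace.ortho {f : HermitianForm K V} (M : f.ClosedSubspace) : f.ClosedSubspace :=
  ⟨f.perp M.1, f.perp_perp_perp M.1⟩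

/-- The Hermitian space is orthomodular: `M + M^⊥ = V` for every `f`-closed subspace `M`. -/
def IsOrthomodular (f : HermitianForm K V) : Prop :=
  ∀ M : f.ClosedSubspace, M.1 ⊔ f.perp M.1 = ⊤

/-- The set `P(V)` of atoms of the lattice `L_f(V)`. -/
def Atom (f : HermitianForm K V) : Type _ := {p : f.ClosedSubspace // IsAtom p}

/-- Orthogonality of atoms: `p ⊥ q` if `p ≤ q^⊥`. -/
def Atom.Orthogonal {f : HermitianForm K V} (p q : f.Atom) : Prop := p.1 ≤ q.1.ortho

/-- The group of orthosymmetries: bijections of the set of atoms that preserve orthogonality in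
both directions. -/
def orthosymmetries (f : HermitianForm K V) : Subgroup (Equiv.Perm f.Atom) where
  carrier := {l | ∀ p q : f.Atom, p.Orthogonal q ↔ (l p).Orthogonal (l q)}
  mul_mem' := by
    intro a b ha hb p q
    exact (hb p q).trans (ha (b p) (b q))
  one_mem' := fun _ _ => Iff.rfl
  inv_mem' := by
    intro a ha p q
    have h := ha (a⁻¹ p) (a⁻¹ q)
    have e : ∀ r, a (a⁻¹ r) = r := fun r => Equiv.apply_symm_apply a r
    rw [e, e] at h
    exact h.symm

/-- The group of orthosymmetries is abundant: any two orthogonal atoms are swapped by some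
orthosymmetry that fixes some superposition of them. -/
def IsAbundant (f : HermitianForm K V) : Prop :=
  ∀ p q : f.Atom, p.Orthogonal q →
    ∃ l ∈ f.orthosymmetries, l p = q ∧ l q = p ∧ ∃ r : f.Atom, r.1 ≤ p.1 ⊔ q.1 ∧ l r = r

/-- The form is regular: every `f(v, v)` is central in `K` and fixed by all (ring) automorphisms
of `K`. -/
def IsRegular (f : HermitianForm K V) : Prop :=
  ∀ v : V, f v v ∈ Subring.center K ∧ ∀ g : K ≃+* K, g (f v v) = f v v

end HermitianForm

/-! An orthosymmetry preserves lines, since the span of two vectors is its own double perp. With a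
third orthogonal direction available, the fundamental theorem of projective geometry applies:
`Sends.exists_ringEquiv` gives a ring automorphism `g` with `[x + a•y] ↦ [x' + g a•y']`. Abundance
supplies a swap of `[x]` and `[y]` fixing some `[v]`; rescaling makes `v = x + y`. Put `α = f x x`,
`β = f y y`. Since `x - αβ⁻¹•y` is orthogonal to `x + y`, so is `y - g(αβ⁻¹)•x`. By regularity `g`
fixes `α` and `β`, so `β = αβ⁻¹α`, whence `α² = β²` as both are central. Anisotropy at `x + y`
excludes `α = -β`. -/

namespace HermitianForm

section Basic

variable {K V : Type*} [DivisionRing K] [StarRing K] [AddCommGroup V] [Module K V]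
  (f : HermitianForm K V)

/-! ### Orthogonal splitting of spans of one or two vectors -/

theorem add_right (u v w : V) : f u (v + w) = f u v + f u w := by
  rw [← f.star_symm (v + w) u, f.add_left, star_add, f.star_symm, f.star_symm]

theorem smul_right (a : K) (u v : V) : f u (a • v) = f u v * star a := by
  rw [← f.star_symm (a • v) u, f.smul_left, star_mul, f.star_symm]

theorem self_ne_zero {v : V} (hv : v ≠ 0) : f v v ≠ 0 := fun h => hv (f.anisotropic v h)

theorem perp_bot : f.perp ⊥ = ⊤ := by
  rw [eq_top_iff]
  intro v _ x hx
  rw [(Submodule.mem_bot K).1 hx]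
  exact f.eq_zero_symm (f.zero_left v)

theorem mem_perp_span_singleton {v x : V} : v ∈ f.perp (K ∙ x) ↔ f v x = 0 := by
  refine ⟨fun h => h x (Submodule.mem_span_singleton_self x), fun h y hy => ?_⟩
  obtain ⟨a, rfl⟩ := Submodule.mem_span_singleton.1 hy
  rw [f.smul_right, h, zero_mul]

theorem perp_sup (M N : Submodule K V) : f.perp (M ⊔ N) = f.perp M ⊓ f.perp N := by
  refine le_antisymm (le_inf (f.perp_anti le_sup_left) (f.perp_anti le_sup_right)) ?_
  rintro v ⟨h1, h2⟩ x hx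
  obtain ⟨m, hm, n, hn, rfl⟩ := Submodule.mem_sup.1 hx
  rw [f.add_right, h1 m hm, h2 n hn, add_zero]

/-- The `M^⊥`-component of a vector of `M^⊥⊥` is orthogonal to itself, hence zero. -/
theorem perp_perp_eq_of_sup_perp {M : Submodule K V} (h : M ⊔ f.perp M = ⊤) :
    f.perp (f.perp M) = M := by
  refine le_antisymm (fun v hv => ?_) (f.le_perp_perp M)
  obtain ⟨m, hm, n, hn, rfl⟩ := Submodule.mem_sup.1 (h ▸ Submodule.mem_top : v ∈ M ⊔ f.perp M)
  have h1 := hv n hn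
  rw [f.add_left, f.eq_zero_symm (hn m hm), zero_add] at h1
  rwa [f.anisotropic n h1, add_zero]

/-- Gram–Schmidt: orthogonal splitting is inherited by adjoining one vector. -/
theorem sup_perp_sup_span_singleton {M : Submodule K V} (h : M ⊔ f.perp M = ⊤) (b : V) :
    (M ⊔ K ∙ b) ⊔ f.perp (M ⊔ K ∙ b) = ⊤ := by
  rw [eq_top_iff]
  intro v _
  obtain ⟨m, hm, b', hb', rfl⟩ := Submodule.mem_sup.1 (h ▸ Submodule.mem_top : b ∈ M ⊔ f.perp M)
  obtain ⟨n, hn, v', hv', rfl⟩ := Submodule.mem_sup.1 (h ▸ Submodule.mem_top : v ∈ M ⊔ f.perp M)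
  have hM : ∀ {y}, y ∈ M → y ∈ M ⊔ K ∙ (m + b') := fun hy => Submodule.mem_sup_left hy
  have hb : b' ∈ M ⊔ K ∙ (m + b') := by
    have h1 : m + b' ∈ M ⊔ K ∙ (m + b') :=
      Submodule.mem_sup_right (Submodule.mem_span_singleton_self _)
    simpa using sub_mem h1 (hM hm)
  -- Gram–Schmidt coefficient along `b'`; it is `0` when `b' = 0`, that is, when `b` already lies in
  -- `M`.
  set c : K := f v' b' * (f b' b')⁻¹ with hc
  have h1 : v' - c • b' ∈ f.perp M := sub_mem hv' (Submodule.smul_mem _ c hb')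
  have h2 : f (v' - c • b') b' = 0 := by
    rw [sub_eq_add_neg, ← neg_smul, f.add_left, f.smul_left]
    rcases eq_or_ne b' 0 with h0 | h0
    · subst h0
      simp [f.eq_zero_symm (f.zero_left v'), f.zero_left]
    · rw [hc, neg_mul, mul_assoc, inv_mul_cancel₀ (f.self_ne_zero h0), mul_one, add_neg_cancel]
  have h3 : n + v' = (n + c • b') + (v' - c • b') := by abel
  rw [h3]
  refine Submodule.add_mem_sup (add_mem (hM hn) (Submodule.smul_mem _ c hb)) ?_
  rw [f.perp_sup]
  refine ⟨h1, f.mem_perp_span_singleton.2 ?_⟩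
  rw [f.add_right, h1 m hm, h2, add_zero]

theorem sup_perp_span_singleton (x : V) : (K ∙ x) ⊔ f.perp (K ∙ x) = ⊤ := by
  have h := f.sup_perp_sup_span_singleton (M := ⊥) (by simp [f.perp_bot]) x
  rwa [bot_sup_eq] at h

theorem perp_perp_span_singleton (x : V) : f.perp (f.perp (K ∙ x)) = K ∙ x :=
  f.perp_perp_eq_of_sup_perp (f.sup_perp_span_singleton x)

theorem sup_perp_span_pair (x y : V) :
    (K ∙ x ⊔ K ∙ y) ⊔ f.perp (K ∙ x ⊔ K ∙ y) = ⊤ :=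
  f.sup_perp_sup_span_singleton (f.sup_perp_span_singleton x) y

theorem perp_perp_span_pair (x y : V) :
    f.perp (f.perp (K ∙ x ⊔ K ∙ y)) = K ∙ x ⊔ K ∙ y :=
  f.perp_perp_eq_of_sup_perp (f.sup_perp_span_pair x y)

/-- In dimension at least three every line has a nonzero vector orthogonal to it. -/
theorem exists_ne_zero_orthogonal (hdim : 3 ≤ Module.rank K V) (x y : V) :
    ∃ z : V, z ≠ 0 ∧ f z x = 0 ∧ f z y = 0 := by
  by_contra! hz
  have h : f.perp (K ∙ x ⊔ K ∙ y) = ⊥ := by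
    rw [eq_bot_iff, f.perp_sup]
    rintro v ⟨h1, h2⟩
    by_contra h0
    exact hz v h0 (f.mem_perp_span_singleton.1 h1) (f.mem_perp_span_singleton.1 h2)
  have h1 := f.sup_perp_span_pair x y
  rw [h, sup_bot_eq, ← Submodule.span_union] at h1
  have h2 := rank_span_le (R := K) ({x} ∪ {y} : Set V)
  rw [h1, rank_top] at h2
  have h3 : Cardinal.mk ({x} ∪ {y} : Set V) ≤ 2 := by
    refine (Cardinal.mk_union_le _ _).trans ?_
    simp [one_add_one_eq_two]
  have h4 : (3 : Cardinal) ≤ 2 := hdim.trans (h2.trans h3)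
  exact absurd h4 (by norm_num)

theorem coeff_eq_of_orthogonal {x y z : V} (hx : x ≠ 0) (hxy : f x y = 0) (hxz : f x z = 0)
    {a b c a' b' c' : K} (h : a • x + b • y + c • z = a' • x + b' • y + c' • z) : a = a' := by
  have h1 := congrArg (fun v => f v x) h
  simp only [f.add_left, f.smul_left, f.eq_zero_symm hxy, f.eq_zero_symm hxz, mul_zero,
    add_zero] at h1
  exact mul_right_cancel₀ (f.self_ne_zero hx) h1

theorem coeffs_eq_of_orthogonal {x y z : V} (hx : x ≠ 0) (hy : y ≠ 0) (hz : z ≠ 0)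
    (hxy : f x y = 0) (hxz : f x z = 0) (hyz : f y z = 0)
    {a b c a' b' c' : K} (h : a • x + b • y + c • z = a' • x + b' • y + c' • z) :
    a = a' ∧ b = b' ∧ c = c' := by
  refine ⟨f.coeff_eq_of_orthogonal hx hxy hxz h,
    f.coeff_eq_of_orthogonal (z := z) hy (f.eq_zero_symm hxy) hyz (a := b) (a' := b') (b := a)
      (b' := a') (c := c) (c' := c') ?_,
    f.coeff_eq_of_orthogonal (z := y) hz (f.eq_zero_symm hxz) (f.eq_zero_symm hyz) (a := c)
      (a' := c') (b := a) (b' := a') (c := b) (c' := b') ?_⟩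
  · rwa [add_comm (b • y), add_comm (b' • y)]
  · rwa [add_assoc, add_comm (c • z), add_assoc (c' • z), add_comm (c' • z)]

/-! ### Atoms as one-dimensional spans -/

theorem ClosedSubspace.bot_val : (⊥ : f.ClosedSubspace).1 = ⊥ := by
  have h : f.perp (f.perp ⊥) = ⊥ := f.perp_perp_eq_of_sup_perp (by rw [f.perp_bot, sup_top_eq])
  have h1 : (⊥ : f.ClosedSubspace) ≤ ⟨⊥, h⟩ := bot_le
  exact le_bot_iff.1 h1

theorem Atom.ne_bot {f : HermitianForm K V} (p : f.Atom) : p.1.1 ≠ ⊥ := fun h =>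
  p.2.1 (Subtype.ext (h.trans (ClosedSubspace.bot_val f).symm))

theorem Atom.eq_span_of_mem {f : HermitianForm K V} (p : f.Atom) {v : V} (hv : v ∈ p.1.1)
    (h0 : v ≠ 0) : p.1.1 = K ∙ v := by
  let s : f.ClosedSubspace := ⟨K ∙ v, f.perp_perp_span_singleton v⟩
  have hs : s ≤ p.1 := (Submodule.span_singleton_le_iff_mem v p.1.1).2 hv
  rcases p.2.le_iff.1 hs with h | h
  · have h1 : K ∙ v = ⊥ := (congrArg Subtype.val h).trans (ClosedSubspace.bot_val f)
    exact absurd (Submodule.span_singleton_eq_bot.1 h1) h0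
  · exact (congrArg Subtype.val h).symm

theorem Atom.exists_eq_span {f : HermitianForm K V} (p : f.Atom) :
    ∃ v : V, v ≠ 0 ∧ p.1.1 = K ∙ v := by
  obtain ⟨v, hv, h0⟩ := Submodule.exists_mem_ne_zero_of_ne_bot p.ne_bot
  exact ⟨v, h0, p.eq_span_of_mem hv h0⟩

theorem Atom.ext_span {f : HermitianForm K V} {p q : f.Atom} (h : p.1.1 = q.1.1) : p = q :=
  Subtype.ext (Subtype.ext h)

theorem exists_atom {v : V} (h0 : v ≠ 0) : ∃ p : f.Atom, p.1.1 = K ∙ v := by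
  refine ⟨⟨⟨K ∙ v, f.perp_perp_span_singleton v⟩, ?_, ?_⟩, rfl⟩
  · intro h
    have h1 : K ∙ v = ⊥ := (congrArg Subtype.val h).trans (ClosedSubspace.bot_val f)
    exact h0 (Submodule.span_singleton_eq_bot.1 h1)
  · intro N hN
    have hle : N.1 ≤ K ∙ v := hN.le
    by_contra hne
    have hN0 : N.1 ≠ ⊥ := fun h => hne (Subtype.ext (h.trans (ClosedSubspace.bot_val f).symm))
    obtain ⟨w, hw, hw0⟩ := Submodule.exists_mem_ne_zero_of_ne_bot hN0
    obtain ⟨a, rfl⟩ := Submodule.mem_span_singleton.1 (hle hw)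
    have ha : a ≠ 0 := by rintro rfl; exact hw0 (zero_smul K v)
    have hv : v ∈ N.1 := by
      simpa [smul_smul, ha] using N.1.smul_mem a⁻¹ hw
    exact hN.not_ge ((Submodule.span_singleton_le_iff_mem v N.1).2 hv)

theorem Atom.orthogonal_iff {f : HermitianForm K V} {p q : f.Atom} {v w : V}
    (hp : p.1.1 = K ∙ v) (hq : q.1.1 = K ∙ w) : p.Orthogonal q ↔ f v w = 0 := by
  change p.1.1 ≤ f.perp q.1.1 ↔ _
  rw [hp, hq, Submodule.span_singleton_le_iff_mem, f.mem_perp_span_singleton]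

/-- The permutation `l` of atoms sends the atom spanned by `v` to the atom spanned by `w`. -/
def Sends {f : HermitianForm K V} (l : Equiv.Perm f.Atom) (v w : V) : Prop :=
  ∃ p : f.Atom, p.1.1 = K ∙ v ∧ (l p).1.1 = K ∙ w

/-! ### Orthosymmetries on representative vectors -/

namespace Sends

variable {f} {l : Equiv.Perm f.Atom} {u v w u' v' w' : V}

theorem ne_zero_left (h : Sends l v w) : v ≠ 0 := by
  obtain ⟨p, hp, -⟩ := h
  rintro rfl
  exact p.ne_bot (by simpa using hp)

theorem ne_zero_right (h : Sends l v w) : w ≠ 0 := by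
  obtain ⟨p, -, hp⟩ := h
  rintro rfl
  exact (l p).ne_bot (by simpa using hp)

theorem symm (h : Sends l v w) : Sends l⁻¹ w v := by
  obtain ⟨p, hp, hp'⟩ := h
  exact ⟨l p, hp', by rw [show l⁻¹ (l p) = p from l.symm_apply_apply p]; exact hp⟩

theorem exists_right (l : Equiv.Perm f.Atom) (hv : v ≠ 0) : ∃ w, Sends l v w := by
  obtain ⟨p, hp⟩ := f.exists_atom hv
  obtain ⟨w, -, hw⟩ := (l p).exists_eq_span
  exact ⟨w, p, hp, hw⟩

theorem exists_left (l : Equiv.Perm f.Atom) (hw : w ≠ 0) : ∃ v, Sends l v w := by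
  obtain ⟨v, hv⟩ := exists_right l⁻¹ hw
  exact ⟨v, by simpa using hv.symm⟩

theorem smul_right (h : Sends l v w) {a : K} (ha : a ≠ 0) : Sends l v (a • w) := by
  obtain ⟨p, hp, hp'⟩ := h
  exact ⟨p, hp, by rw [hp', Submodule.span_singleton_smul_eq (IsUnit.mk0 a ha)]⟩

theorem smul_left (h : Sends l v w) {a : K} (ha : a ≠ 0) : Sends l (a • v) w := by
  simpa using (h.symm.smul_right ha).symm

theorem eq_smul (h : Sends l v w) (h' : Sends l v w') : ∃ a : K, a ≠ 0 ∧ w' = a • w := by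
  have h0 := h'.ne_zero_right
  obtain ⟨p, hp, hp'⟩ := h
  obtain ⟨q, hq, hq'⟩ := h'
  obtain rfl : p = q := Atom.ext_span (hp.trans hq.symm)
  have hw : w' ∈ K ∙ w := by
    rw [← hp', hq']
    exact Submodule.mem_span_singleton_self w'
  obtain ⟨a, rfl⟩ := Submodule.mem_span_singleton.1 hw
  exact ⟨a, fun ha => h0 (by rw [ha, zero_smul]), rfl⟩

theorem form_eq_zero_iff (hl : l ∈ f.orthosymmetries) (hu : Sends l u u') (hv : Sends l v v') :
    f u v = 0 ↔ f u' v' = 0 := by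
  obtain ⟨p, hp, hp'⟩ := hu
  obtain ⟨q, hq, hq'⟩ := hv
  rw [← Atom.orthogonal_iff hp hq, ← Atom.orthogonal_iff hp' hq']
  exact hl p q

/-- Orthosymmetries preserve collinearity, a line being a double orthogonal complement. -/
theorem mem_line (hl : l ∈ f.orthosymmetries) (hu : Sends l u u') (hv : Sends l v v')
    (hw : Sends l w w') {a b : K} (h : w = a • u + b • v) :
    ∃ a' b' : K, w' = a' • u' + b' • v' := by
  have h1 : w' ∈ f.perp (f.perp (K ∙ u' ⊔ K ∙ v')) := by
    intro t' ht'
    rcases eq_or_ne t' 0 with rfl | h0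
    · exact f.eq_zero_symm (f.zero_left w')
    rw [f.perp_sup] at ht'
    have h1 := f.mem_perp_span_singleton.1 ht'.1
    have h2 := f.mem_perp_span_singleton.1 ht'.2
    obtain ⟨t, ht⟩ := exists_left l h0
    rw [← form_eq_zero_iff hl ht hu] at h1
    rw [← form_eq_zero_iff hl ht hv] at h2
    rw [← form_eq_zero_iff hl hw ht, h, f.linear_left, f.eq_zero_symm h1, f.eq_zero_symm h2]
    simp
  rw [f.perp_perp_span_pair] at h1
  obtain ⟨y, hy, z, hz, rfl⟩ := Submodule.mem_sup.1 h1
  obtain ⟨a', rfl⟩ := Submodule.mem_span_singleton.1 hy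
  obtain ⟨b', rfl⟩ := Submodule.mem_span_singleton.1 hz
  exact ⟨a', b', rfl⟩

/-- The image of a vector outside the axis `v` on a line, normalized at `u'`. -/
theorem exists_coord (hl : l ∈ f.orthosymmetries) (hu : Sends l u u') (hv : Sends l v v')
    (huv : f u v = 0) (a : K) : ∃ b : K, Sends l (u + a • v) (u' + b • v') := by
  have h0 : f (u + a • v) u ≠ 0 := by
    rw [f.add_left, f.smul_left, f.eq_zero_symm huv, mul_zero, add_zero]
    exact f.self_ne_zero hu.ne_zero_left
  have h1 : u + a • v ≠ 0 := fun h => h0 (by rw [h, f.zero_left])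
  obtain ⟨w, hw⟩ := exists_right l h1
  obtain ⟨c, d, rfl⟩ := mem_line hl hu hv hw (a := 1) (b := a) (by rw [one_smul])
  -- If `c = 0`, the image would be `[v']`, orthogonal to `u'`, whereas `u + a • v` is not
  -- orthogonal to `u`.
  have hc : c ≠ 0 := by
    rintro rfl
    apply h0
    rw [form_eq_zero_iff hl hw hu, f.add_left, f.smul_left, f.smul_left,
      f.eq_zero_symm ((form_eq_zero_iff hl hu hv).1 huv)]
    simp
  refine ⟨c⁻¹ * d, ?_⟩
  simpa [smul_smul, hc] using hw.smul_right (inv_ne_zero hc)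

theorem coord_unique (hu : u ≠ 0) (hv : v ≠ 0) (huv : f u v = 0) {a b : K}
    (ha : Sends l w (u + a • v)) (hb : Sends l w (u + b • v)) : a = b := by
  obtain ⟨c, -, h⟩ := ha.eq_smul hb
  have h1 := congrArg (fun t => f t u) h
  have h2 := congrArg (fun t => f t v) h
  simp only [f.add_left, f.smul_left, f.eq_zero_symm huv, huv, mul_zero, add_zero,
    zero_add] at h1 h2
  obtain rfl : 1 = c := mul_right_cancel₀ (f.self_ne_zero hu) (by rw [one_mul]; exact h1)
  rw [one_mul] at h2
  exact (mul_right_cancel₀ (f.self_ne_zero hv) h2).symm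

/-! ### The coordinate automorphism in an orthogonal frame -/

section Coordinates

variable {x y z x' y' z' : V} {g h : K → K}

/-- `[x + a•y + b•z]` is on the line from `[x + a•y]` to `[z]` and on the line from `[x + b•z]` to
`[y]`; the images of these lines determine its image. -/
theorem plane (hl : l ∈ f.orthosymmetries) (hx : Sends l x x') (hy : Sends l y y')
    (hz : Sends l z z') (hxy : f x y = 0) (hxz : f x z = 0) (hyz : f y z = 0)
    (hg : ∀ a, Sends l (x + a • y) (x' + g a • y'))
    (hh : ∀ a, Sends l (x + a • z) (x' + h a • z')) (a b : K) :
    Sends l (x + a • y + b • z) (x' + g a • y' + h b • z') := by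
  have h0 : x + a • y + b • z ≠ 0 := by
    intro h
    refine one_ne_zero (α := K) (f.coeff_eq_of_orthogonal (a := 1) (b := a) (c := b) (a' := 0)
      (b' := 0) (c' := 0) hx.ne_zero_left hxy hxz ?_)
    simpa using h
  obtain ⟨w, hw⟩ := exists_right l h0
  obtain ⟨α, β, h1⟩ := mem_line hl (hg a) hz hw (a := 1) (b := b) (by rw [one_smul])
  obtain ⟨γ, δ, h2⟩ := mem_line hl (hh b) hy hw (a := 1) (b := a)
    (by rw [one_smul, add_right_comm])
  obtain ⟨e1, -, e3⟩ := f.coeffs_eq_of_orthogonal hx.ne_zero_right hy.ne_zero_right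
    hz.ne_zero_right ((form_eq_zero_iff hl hx hy).1 hxy) ((form_eq_zero_iff hl hx hz).1 hxz)
    ((form_eq_zero_iff hl hy hz).1 hyz) (a := α) (b := α * g a) (c := β) (a' := γ) (b' := δ)
    (c' := γ * h b) (by
      rw [mul_smul, mul_smul, ← smul_add, ← h1, h2, smul_add]
      abel)
  have h3 : w = α • (x' + g a • y' + h b • z') := by
    rw [h1, e3, ← e1, smul_add α (x' + g a • y'), mul_smul]
  have hα : α ≠ 0 := fun hα => hw.ne_zero_right (by rw [h3, hα, zero_smul])
  simpa [h3, smul_smul, hα] using hw.smul_right (inv_ne_zero hα)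

/-- The point is where the line through `[y]`, `[z]` meets the line through `[x + a•y + b•z]`,
`[x]`. -/
theorem axis (hl : l ∈ f.orthosymmetries) (hx : Sends l x x') (hy : Sends l y y')
    (hz : Sends l z z') (hxy : f x y = 0) (hxz : f x z = 0) (hyz : f y z = 0)
    (hg : ∀ a, Sends l (x + a • y) (x' + g a • y'))
    (hh : ∀ a, Sends l (x + a • z) (x' + h a • z')) {a b : K} (h0 : a • y + b • z ≠ 0) :
    Sends l (a • y + b • z) (g a • y' + h b • z') := by
  obtain ⟨w, hw⟩ := exists_right l h0
  obtain ⟨α, β, h1⟩ := mem_line hl hy hz hw rfl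
  obtain ⟨γ, δ, h2⟩ := mem_line hl (plane hl hx hy hz hxy hxz hyz hg hh a b) hx hw (a := 1)
    (b := -1) (by rw [one_smul, neg_one_smul]; abel)
  obtain ⟨-, e2, e3⟩ := f.coeffs_eq_of_orthogonal hx.ne_zero_right hy.ne_zero_right
    hz.ne_zero_right ((form_eq_zero_iff hl hx hy).1 hxy) ((form_eq_zero_iff hl hx hz).1 hxz)
    ((form_eq_zero_iff hl hy hz).1 hyz) (a := 0) (b := α) (c := β) (a' := γ + δ) (b' := γ * g a)
    (c' := γ * h b) (by
      rw [zero_smul, zero_add, ← h1, h2, smul_add, smul_add, add_smul, mul_smul, mul_smul]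
      abel)
  have h3 : w = γ • (g a • y' + h b • z') := by
    rw [h1, e2, e3, smul_add, mul_smul, mul_smul]
  have hγ : γ ≠ 0 := fun hγ => hw.ne_zero_right (by rw [h3, hγ, zero_smul])
  simpa [h3, smul_smul, hγ] using hw.smul_right (inv_ne_zero hγ)

/-- In an orthogonal frame normalized at `x + y`, an orthosymmetry acts on the coordinates of the
line through `x` and `y` by a ring automorphism. -/
theorem exists_ringEquiv (hl : l ∈ f.orthosymmetries) (hx : Sends l x x') (hy : Sends l y y')
    (hxyS : Sends l (x + y) (x' + y')) (hz : z ≠ 0)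
    (hxy : f x y = 0) (hxz : f x z = 0) (hyz : f y z = 0) :
    ∃ g : K ≃+* K, ∀ a, Sends l (x + a • y) (x' + g a • y') := by
  obtain ⟨z₀, hz₀⟩ := exists_right l hz
  obtain ⟨c, hc⟩ := exists_coord hl hx hz₀ hxz 1
  rw [one_smul] at hc
  have hx0 := hx.ne_zero_right
  have hy0 := hy.ne_zero_right
  have hxy' := (form_eq_zero_iff hl hx hy).1 hxy
  have hc0 : c ≠ 0 := by
    rintro rfl
    rw [zero_smul, add_zero] at hc
    have h1 := (form_eq_zero_iff hl hc hz₀).2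
      ((form_eq_zero_iff hl hx hz₀).1 hxz)
    rw [f.add_left, hxz, zero_add] at h1
    exact f.self_ne_zero hz h1
  -- Rescaling the image of `z` makes `[x + z]` go to `[x' + z']`, so that `h 1 = 1`.
  have hzS := hz₀.smul_right hc0
  generalize c • z₀ = z' at hc hzS
  have hz0 := hzS.ne_zero_right
  have hxz' := (form_eq_zero_iff hl hx hzS).1 hxz
  have hyz' := (form_eq_zero_iff hl hy hzS).1 hyz
  choose g hg using exists_coord hl hx hy hxy
  choose h hh using exists_coord hl hx hzS hxz
  have hg0 : g 0 = 0 := coord_unique hx0 hy0 hxy' (hg 0) (by simpa using hx)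
  have hg1 : g 1 = 1 := coord_unique hx0 hy0 hxy' (hg 1) (by simpa using hxyS)
  have hh1 : h 1 = 1 := coord_unique hx0 hz0 hxz' (hh 1) (by simpa using hc)
  have nz : ∀ a : K, a • y + (1 : K) • z ≠ 0 := by
    intro a ha
    have h1 := congrArg (fun t => f t z) ha
    simp only [f.add_left, f.smul_left, hyz, f.zero_left, mul_zero, zero_add, one_mul] at h1
    exact f.self_ne_zero hz h1
  -- `b•y + z` and its multiple `(a * b)•y + a•z` span the same atom; their two images via `axis`
  -- are proportional with factor `h a`.
  have key : ∀ a b : K, a ≠ 0 → g (a * b) = h a * g b := by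
    intro a b ha
    have h1 := axis hl hx hy hzS hxy hxz hyz hg hh (nz b)
    have h2 : Sends l (b • y + (1 : K) • z) (g (a * b) • y' + h a • z') := by
      have h3 : a • (b • y + (1 : K) • z) = (a * b) • y + a • z := by
        rw [smul_add, smul_smul, smul_smul, mul_one]
      have h4 := axis hl hx hy hzS hxy hxz hyz hg hh (a := a * b) (b := a)
        (by rw [← h3]; exact smul_ne_zero ha (nz b))
      rw [← h3] at h4
      simpa [smul_smul, ha] using h4.smul_left (inv_ne_zero ha)
    obtain ⟨d, -, hd⟩ := h1.eq_smul h2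
    obtain ⟨-, e2, e3⟩ := f.coeffs_eq_of_orthogonal hx0 hy0 hz0 hxy' hxz' hyz' (a := 0)
      (b := g (a * b)) (c := h a) (a' := 0) (b' := d * g b) (c' := d) (by
        rw [zero_smul, zero_add, zero_add, hd, hh1, one_smul, smul_add, mul_smul])
    rw [e2, e3]
  have hgh : ∀ a, a ≠ 0 → g a = h a := by
    intro a ha
    simpa [hg1] using key a 1 ha
  have hmul : ∀ a b, g (a * b) = g a * g b := by
    intro a b
    rcases eq_or_ne a 0 with rfl | ha
    · rw [zero_mul, hg0, zero_mul]
    · rw [key a b ha, hgh a ha]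
  -- `x + (a + b)•y + z` is the sum of `x + a•y` and `b•y + z`; in the image, the `x'` and `z'`
  -- coordinates force both coefficients to be `1`.
  have hadd : ∀ a b, g (a + b) = g a + g b := by
    intro a b
    obtain ⟨α, β, h1⟩ := mem_line hl (hg a) (axis hl hx hy hzS hxy hxz hyz hg hh (nz b))
      (plane hl hx hy hzS hxy hxz hyz hg hh (a + b) 1) (a := 1) (b := 1)
      (by rw [one_smul K (x + _), one_smul K (b • y + _), add_smul]; abel)
    obtain ⟨e1, e2, e3⟩ := f.coeffs_eq_of_orthogonal hx0 hy0 hz0 hxy' hxz' hyz' (a := 1)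
      (b := g (a + b)) (c := 1) (a' := α) (b' := α * g a + β * g b) (c' := β) (by
        rw [hh1, one_smul] at h1
        rw [one_smul, one_smul, h1, smul_add, smul_add, add_smul, mul_smul, mul_smul]
        abel)
    rw [e2, ← e1, ← e3, one_mul, one_mul]
  let G : K →+* K :=
    { toFun := g, map_one' := hg1, map_mul' := hmul, map_zero' := hg0, map_add' := hadd }
  -- A preimage is read off from the coordinates of the inverse orthosymmetry.
  have hsurj : Function.Surjective G := by
    intro b
    obtain ⟨a, ha⟩ := exists_coord ((f.orthosymmetries).inv_mem hl) hx.symm hy.symm hxy' b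
    have h1 : Sends l (x + a • y) (x' + b • y') := by simpa using ha.symm
    exact ⟨a, coord_unique hx0 hy0 hxy' (hg a) h1⟩
  exact ⟨RingEquiv.ofBijective G ⟨G.injective, hsurj⟩, hg⟩

end Coordinates

end Sends

/-! ### Comparing lengths under a swap -/

theorem self_eq_of_sends_swap {f : HermitianForm K V} {l : Equiv.Perm f.Atom}
    (hl : l ∈ f.orthosymmetries) (hregular : f.IsRegular) (hdim : 3 ≤ Module.rank K V) {x y : V}
    (hxy : f x y = 0) (hx : Sends l x y) (hy : Sends l y x) (hxyS : Sends l (x + y) (x + y)) :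
    f x x = f y y := by
  obtain ⟨z, hz, hzx, hzy⟩ := f.exists_ne_zero_orthogonal hdim x y
  obtain ⟨g, hg⟩ := Sends.exists_ringEquiv hl hx hy (by rwa [add_comm y x]) hz hxy
    (f.eq_zero_symm hzx) (f.eq_zero_symm hzy)
  have hyx := f.eq_zero_symm hxy
  set a := f x x with ha
  set b := f y y with hb
  have hb0 : b ≠ 0 := f.self_ne_zero hx.ne_zero_right
  have hcomm : a * b = b * a := (Subring.mem_center_iff.1 (hregular x).1 b).symm
  have h1 : f (x + (-(a * b⁻¹)) • y) (x + y) = 0 := by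
    rw [f.add_left, f.smul_left, f.add_right, f.add_right, hxy, hyx, ← ha, ← hb, add_zero,
      zero_add, neg_mul, mul_assoc, inv_mul_cancel₀ hb0, mul_one, add_neg_cancel]
  rw [Sends.form_eq_zero_iff hl (hg _) hxyS, f.add_left, f.smul_left, f.add_right, f.add_right,
    hxy, hyx, ← ha, ← hb, add_zero, zero_add, map_neg, map_mul, map_inv₀, (hregular x).2 g,
    (hregular y).2 g, ← ha, ← hb] at h1
  have h2 : b * b = a * a := by
    have h3 : b = a * b⁻¹ * a := by
      rwa [neg_mul, ← sub_eq_add_neg, sub_eq_zero] at h1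
    have h4 : b⁻¹ * a = a * b⁻¹ := by
      rw [inv_mul_eq_iff_eq_mul₀ hb0, ← mul_assoc, ← hcomm, mul_assoc, mul_inv_cancel₀ hb0,
        mul_one]
    rw [mul_assoc, h4] at h3
    nth_rewrite 1 [h3]
    rw [mul_assoc, mul_assoc, inv_mul_cancel₀ hb0, mul_one]
  have hcom : Commute a b := hcomm
  rcases hcom.mul_self_eq_mul_self_iff.1 h2.symm with h | h
  · exact h
  · exfalso
    have h0 : f (x + y) (x + y) = 0 := by
      rw [f.add_left, f.add_right, f.add_right, hxy, hyx, ← ha, ← hb, h]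
      simp
    exact f.self_ne_zero hxyS.ne_zero_left h0

end Basic

end HermitianForm

open HermitianForm in
theorem mainTheorem7 {K V : Type*} [DivisionRing K] [StarRing K] [AddCommGroup V] [Module K V]
    (f : HermitianForm K V) (hom : f.IsOrthomodular) (hdim : 3 ≤ Module.rank K V)
    (habundant : f.IsAbundant) (hregular : f.IsRegular)
    (p q : f.Atom) (hpq : p.Orthogonal q) :
    ∃ x' ∈ p.1.1, ∃ y' ∈ q.1.1, x' ≠ 0 ∧ y' ≠ 0 ∧ f x' x' = f y' y' := by
  obtain ⟨l, hl, hlp, hlq, r, hr, hlr⟩ := habundant p q hpq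
  obtain ⟨x, hx0, hx⟩ := p.exists_eq_span
  obtain ⟨y, hy0, hy⟩ := q.exists_eq_span
  obtain ⟨v, hv0, hv⟩ := r.exists_eq_span
  have hxy : f x y = 0 := (Atom.orthogonal_iff hx hy).1 hpq
  have hxS : Sends l x y := ⟨p, hx, by rw [hlp, hy]⟩
  have hyS : Sends l y x := ⟨q, hy, by rw [hlq, hx]⟩
  have hvS : Sends l v v := ⟨r, hv, by rw [hlr, hv]⟩
  -- The join of atoms is the closure of their sum, which is already closed.
  have hvm : v ∈ K ∙ x ⊔ K ∙ y := by
    let s : f.ClosedSubspace := ⟨K ∙ x ⊔ K ∙ y, f.perp_perp_span_pair x y⟩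
    have hp : p.1 ≤ s := by
      change p.1.1 ≤ K ∙ x ⊔ K ∙ y
      rw [hx]
      exact le_sup_left
    have hq : q.1 ≤ s := by
      change q.1.1 ≤ K ∙ x ⊔ K ∙ y
      rw [hy]
      exact le_sup_right
    have hrs : r.1.1 ≤ K ∙ x ⊔ K ∙ y := hr.trans (sup_le hp hq)
    exact hrs (hv ▸ Submodule.mem_span_singleton_self v)
  obtain ⟨x₁, hx₁, y₁, hy₁, rfl⟩ := Submodule.mem_sup.1 hvm
  obtain ⟨a, rfl⟩ := Submodule.mem_span_singleton.1 hx₁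
  obtain ⟨b, rfl⟩ := Submodule.mem_span_singleton.1 hy₁
  have hyx := f.eq_zero_symm hxy
  -- As `[v]` is fixed and `[x] ↦ [y]`, `v ⊥ x` iff `v ⊥ y`; so `a` and `b` vanish together, which
  -- `v ≠ 0` forbids.
  have hiff := Sends.form_eq_zero_iff hl hvS hxS
  simp only [f.add_left, f.smul_left, hxy, hyx, mul_zero, add_zero, zero_add, mul_eq_zero,
    f.self_ne_zero hx0, f.self_ne_zero hy0, or_false] at hiff
  have ha : a ≠ 0 := fun ha => hv0 (by rw [ha, hiff.1 ha]; simp)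
  have hb : b ≠ 0 := fun hb => ha (hiff.2 hb)
  refine ⟨a • x, hx ▸ hx₁, b • y, hy ▸ hy₁, smul_ne_zero ha hx0, smul_ne_zero hb hy0, ?_⟩
  refine self_eq_of_sends_swap hl hregular hdim ?_ ((hxS.smul_right hb).smul_left ha)
    ((hyS.smul_right ha).smul_left hb) hvS
  rw [f.smul_left, f.smul_right, hxy]
  simp
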